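/- **Lemma 2.3.** Let $N\in\mathbb N$ and let $|\cdot|$ be the Euclidean norm on $\mathbb R^N$. *(Banach case.)* Let $\mathcal B$ be a real Banach space and $Z\subset\mathcal B$ a set, and let $(V_j)_{j\ge1}$ be linear subspaces of $\mathcal B^*$ with $\dim V_j\le M'$ for all $j$, such that for every $n\ge1$ and every $z\in Z$ with $2^{-(n+1)}\le\|z\|\le2^{-n}$ there is $\psi\in V_n$ with $\|\psi\|=1$ and $|\psi(z)|\ge2^{-(n+3)}$. (Such $V_j$ exist, for some $M'$, when $Z=X-X$ is compact and homogeneous.) Let $S_j$ be the closed unit ball of $V_j$, let $\lambda_j$ be the uniform probability measure on $S_j$ (normalised Lebesgue measure in the coordinates of any basis of $V_j$), let $s>1$, and let $$E=\Big\{L=(L_1,\dots,L_N):\ L_n=\sum_{j=1}^\infty j^{-s}\phi_{nj},\ \phi_{nj}\in S_j\Big\}\subset\mathscr L(\mathcal B,\mathbb R^N).$$ Let $\mu$ be the law of $L$ when the $\phi_{nj}$ are independent, $\phi_{nj}$ having law $\lambda_j$. Then for every integer $j\ge1$, every $z\in Z$ with $2^{-(j+1)}\le\|z\|\le2^{-j}$,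 every bounded linear $f:\mathcal B\to\mathbb R^N$ and every $\epsilon>0$, $$\mu\{L\in E:\ |(f+L)z|<\epsilon2^{-j}\}\le C\,\epsilon^N j^{sN},$$ where $C$ depends only on $N$ and $M'$. *(Hilbert case.)* Let $H$ be a real Hilbert space and $Z\subset H$ a set, and let $(V_j)_{j\ge1}$ be mutually orthogonal linear subspaces of $H$ with $\sup_j\dim V_j<\infty$, such that for every $n\ge1$ and every $z\in Z$ with $2^{-(n+1)}\le\|z\|\le2^{-n}$ one has $\|\Pi_nz\|\ge2^{-(n+2)}$, where $\Pi_n$ is the orthogonal projection onto $V_1\oplus\dots\oplus V_n$. (Such $V_j$ exist when $Z=X-X$ is compact and homogeneous.) Choose an orthonormal basis $(e_j^{(i)})_i$ of each $V_j$, let $C_j=\{u\in V_j:\ |(u,e_j^{(i)})|\le\tfrac12\text{ for all }i\}$, let $s>\tfrac12$, and let $$E=\Big\{L=(L_1,\dots,L_N):\ L_n=\Big(\sum_{j=1}^\infty j^{-s}\phi_{nj},\ \cdot\ \Big),\ \phi_{nj}\in C_j\Big\}\subset\mathscr L(H,\mathbb R^N).$$ Let $\mu$ be the law of $L$ when the $\phi_{nj}$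 are independent and uniformly distributed on $C_j$. Then for every integer $j\ge1$, every $z\in Z$ with $2^{-(j+1)}\le\|z\|\le2^{-j}$, every bounded linear $f:H\to\mathbb R^N$ and every $\epsilon>0$, $$\mu\{L\in E:\ |(f+L)z|<\epsilon2^{-j}\}\le C\,\epsilon^N j^{sN},$$ where $C$ depends only on $N$. -/

import Mathlib

universe u

open MeasureTheory ProbabilityTheory Filter Topology

namespace LogLip

noncomputable section

section UniformLaw

variable {W : Type*} [NormedAddCommGroup W] [NormedSpace ℝ W] {d : ℕ}

lemma continuous_coord_symm (b : Module.Basis (Fin d) ℝ W) : Continuous b.equivFun.symm :=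
  LinearMap.continuous_of_finiteDimensional b.equivFun.symm.toLinearMap

lemma continuous_coord (b : Module.Basis (Fin d) ℝ W) : Continuous b.equivFun :=
  have : FiniteDimensional ℝ W := b.finiteDimensional_of_finite
  LinearMap.continuous_of_finiteDimensional b.equivFun.toLinearMap

variable [MeasurableSpace W] [BorelSpace W]

/-- The uniform probability measure on a subset `S` of a finite-dimensional space `W`: `S` is
identified, by coordinates with respect to the basis `b`, with a subset of `ℝ ^ d`, on which
Lebesgue measure is restricted and normalised. -/
def uniformLaw (b : Module.Basis (Fin d) ℝ W) (S : Set W) : Measure W :=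
  (ProbabilityTheory.cond (volume : Measure (Fin d → ℝ)) (b.equivFun '' S)).map b.equivFun.symm

lemma isProbabilityMeasure_uniformLaw (b : Module.Basis (Fin d) ℝ W) {S : Set W}
    (hS : IsCompact S) (h0 : S ∈ 𝓝 (0 : W)) : IsProbabilityMeasure (uniformLaw b S) := by
  have himg : b.equivFun '' S = b.equivFun.symm ⁻¹' S := b.equivFun.toEquiv.image_eq_preimage_symm S
  have hc : IsCompact (b.equivFun '' S) := hS.image (continuous_coord b)
  have hpos : volume (b.equivFun '' S) ≠ 0 := by
    refine (Measure.measure_pos_of_mem_nhds volume (x := (0 : Fin d → ℝ)) ?_).ne'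
    rw [himg]
    refine (continuous_coord_symm b).continuousAt.preimage_mem_nhds ?_
    rwa [map_zero]
  have := cond_isProbabilityMeasure_of_finite hpos hc.measure_lt_top.ne
  exact Measure.isProbabilityMeasure_map (continuous_coord_symm b).measurable.aemeasurable

lemma ae_mem_uniformLaw (b : Module.Basis (Fin d) ℝ W) {S : Set W} (hS : IsCompact S) :
    ∀ᵐ x ∂uniformLaw b S, x ∈ S := by
  have himg : b.equivFun '' S = b.equivFun.symm ⁻¹' S := b.equivFun.toEquiv.image_eq_preimage_symm S
  have hc : IsCompact (b.equivFun '' S) := hS.image (continuous_coord b)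
  refine (ae_map_iff (continuous_coord_symm b).measurable.aemeasurable hS.measurableSet).2 ?_
  filter_upwards [ae_cond_mem hc.measurableSet] with x hx
  rwa [himg] at hx

end UniformLaw

section Ball

variable {D : Type*} [NormedAddCommGroup D] [NormedSpace ℝ D]

lemma isCompact_ball (V : Submodule ℝ D) [FiniteDimensional ℝ V] :
    IsCompact (Metric.closedBall (0 : V) 1) :=
  have : ProperSpace V := FiniteDimensional.proper_real V
  isCompact_closedBall 0 1

variable [MeasurableSpace D] [BorelSpace D]

/-- The uniform probability measure on the closed unit ball of a finite-dimensional subspace of a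
normed space `D`. -/
def ballLaw (V : Submodule ℝ D) (b : Module.Basis (Fin (Module.finrank ℝ V)) ℝ V) : Measure V :=
  uniformLaw b (Metric.closedBall 0 1)

instance isProbabilityMeasure_ballLaw (V : Submodule ℝ D) [FiniteDimensional ℝ V]
    (b : Module.Basis (Fin (Module.finrank ℝ V)) ℝ V) : IsProbabilityMeasure (ballLaw V b) :=
  isProbabilityMeasure_uniformLaw b (isCompact_ball V) (Metric.closedBall_mem_nhds 0 one_pos)

lemma ae_mem_ballLaw (V : Submodule ℝ D) [FiniteDimensional ℝ V]
    (b : Module.Basis (Fin (Module.finrank ℝ V)) ℝ V) :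
    ∀ᵐ x ∂ballLaw V b, x ∈ Metric.closedBall (0 : V) 1 :=
  ae_mem_uniformLaw b (isCompact_ball V)

end Ball

section Assemble

variable {B : Type*} [NormedAddCommGroup B] [NormedSpace ℝ B] {N : ℕ}

/-- The bounded linear map `L = (L₁, …, L_N)` into Euclidean space with components `ℓ n`. -/
def assemble (ℓ : Fin N → StrongDual ℝ B) : B →L[ℝ] EuclideanSpace ℝ (Fin N) :=
  ((EuclideanSpace.equiv (Fin N) ℝ).symm : (Fin N → ℝ) →L[ℝ] EuclideanSpace ℝ (Fin N)).comp
    (ContinuousLinearMap.pi ℓ)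

lemma assemble_apply (ℓ : Fin N → StrongDual ℝ B) (x : B) (n : Fin N) :
    assemble ℓ x n = ℓ n x := rfl

lemma continuous_assemble :
    Continuous (assemble : (Fin N → StrongDual ℝ B) → B →L[ℝ] EuclideanSpace ℝ (Fin N)) := by
  have h : (assemble : (Fin N → StrongDual ℝ B) → B →L[ℝ] EuclideanSpace ℝ (Fin N)) =
      fun ℓ => ∑ n, ContinuousLinearMap.smulRightL ℝ B (EuclideanSpace ℝ (Fin N)) (ℓ n)
        (EuclideanSpace.single n (1 : ℝ)) := by
    funext ℓ
    ext x n
    simp [assemble_apply, Pi.single_apply]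
  rw [h]
  fun_prop

/-- The law of `N` independent sequences `(φ_{n1}, φ_{n2}, …)`, `n = 1, …, N`, whose terms `φ_{nj}`
are independent with law `ν j`. -/
def sequenceLaw {W : ℕ+ → Type*} [∀ j, MeasurableSpace (W j)] (N : ℕ) (ν : ∀ j, Measure (W j))
    [∀ j, IsProbabilityMeasure (ν j)] : Measure (Fin N → ∀ j, W j) :=
  Measure.pi fun _ => Measure.infinitePi ν

instance {W : ℕ+ → Type*} [∀ j, MeasurableSpace (W j)] (N : ℕ) (ν : ∀ j, Measure (W j))
    [∀ j, IsProbabilityMeasure (ν j)] : IsProbabilityMeasure (sequenceLaw N ν) := by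
  unfold sequenceLaw; infer_instance

lemma ae_sequenceLaw {W : ℕ+ → Type*} [∀ j, MeasurableSpace (W j)] (N : ℕ) (ν : ∀ j, Measure (W j))
    [∀ j, IsProbabilityMeasure (ν j)] (S : ∀ j, Set (W j)) (h : ∀ j, ∀ᵐ x ∂ν j, x ∈ S j) :
    ∀ᵐ φ ∂sequenceLaw N ν, ∀ n j, φ n j ∈ S j := by
  refine ae_all_iff.2 fun n => ae_all_iff.2 fun j => ?_
  have h1 := (measurePreserving_eval (fun _ : Fin N => Measure.infinitePi ν) n).quasiMeasurePreserving
  have h2 := (measurePreserving_eval_infinitePi ν j).quasiMeasurePreserving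
  exact (h2.comp h1).ae (h j)

/-- A random series of maps with terms depending continuously on the finite-dimensional data is
measurable as soon as it converges almost surely. -/
lemma aemeasurable_series {W : ℕ+ → Type*} [∀ j, NormedAddCommGroup (W j)]
    [∀ j, NormedSpace ℝ (W j)] [∀ j, FiniteDimensional ℝ (W j)] [∀ j, MeasurableSpace (W j)]
    [∀ j, BorelSpace (W j)] {ν : ∀ j, Measure (W j)} [∀ j, IsProbabilityMeasure (ν j)]
    {X : Type*} [NormedAddCommGroup X] {T : ∀ j, W j → X} (hT : ∀ j, Continuous (T j))
    {g : X → StrongDual ℝ B} (hg : Continuous g)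
    (hs : ∀ᵐ φ ∂sequenceLaw N ν, ∀ n, Summable fun j => T j (φ n j)) :
    AEMeasurable (fun φ : Fin N → ∀ j, W j => assemble fun n => g (∑' j, T j (φ n j)))
      (sequenceLaw N ν) := by
  have (j : ℕ+) : ProperSpace (W j) := FiniteDimensional.proper_real (W j)
  have (j : ℕ+) : SecondCountableTopology (W j) := inferInstance
  refine aemeasurable_of_tendsto_metrizable_ae (atTop : Filter (Finset ℕ+))
    (f := fun F φ => assemble fun n => g (∑ j ∈ F, T j (φ n j))) (fun F => ?_) ?_
  · refine Continuous.aemeasurable (continuous_assemble.comp (continuous_pi fun n => hg.comp ?_))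
    refine continuous_finsetSum _ fun j _ => (hT j).comp ?_
    fun_prop
  · filter_upwards [hs] with φ hφ
    refine (continuous_assemble.tendsto _).comp (tendsto_pi_nhds.2 fun n => ?_)
    exact (hg.tendsto _).comp (hφ n).hasSum

end Assemble

section Banach

variable {B : Type*} [NormedAddCommGroup B] [NormedSpace ℝ B]

/-- The subspaces `V j` of the dual of `B` detect the elements of `Z`: if `z ∈ Z` has norm between
`2 ^ (-(n + 1))` and `2 ^ (-n)`, some norm-one functional in `V n` is at least `2 ^ (-(n + 3))`
at `z` in absolute value. -/
def DualDetects (V : ℕ+ → Submodule ℝ (StrongDual ℝ B)) (Z : Set B) : Prop :=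
  ∀ n : ℕ+, ∀ z ∈ Z, (1 / 2 : ℝ) ^ ((n : ℕ) + 1) ≤ ‖z‖ → ‖z‖ ≤ (1 / 2 : ℝ) ^ (n : ℕ) →
    ∃ ψ ∈ V n, ‖ψ‖ = 1 ∧ (1 / 2 : ℝ) ^ ((n : ℕ) + 3) ≤ |ψ z|

lemma summable_pnat_rpow {s : ℝ} (hs : 1 < s) : Summable fun j : ℕ+ => ((j : ℕ) : ℝ) ^ (-s) :=
  (Real.summable_nat_rpow.2 (by linarith)).comp_injective PNat.coe_injective

lemma summable_banach (V : ℕ+ → Submodule ℝ (StrongDual ℝ B)) {s : ℝ} (hs : 1 < s) {φ : ∀ j, V j}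
    (hφ : ∀ j, φ j ∈ Metric.closedBall (0 : V j) 1) :
    Summable fun j : ℕ+ => ((j : ℕ) : ℝ) ^ (-s) • (φ j : StrongDual ℝ B) := by
  refine (summable_pnat_rpow hs).of_norm_bounded fun j => ?_
  have h1 : ‖(φ j : StrongDual ℝ B)‖ ≤ 1 := mem_closedBall_zero_iff.1 (hφ j)
  have h2 : 0 ≤ ((j : ℕ) : ℝ) ^ (-s) := by positivity
  rw [norm_smul, Real.norm_of_nonneg h2]
  exact mul_le_of_le_one_right h2 h1

variable (V : ℕ+ → Submodule ℝ (StrongDual ℝ B)) [∀ j, FiniteDimensional ℝ (V j)]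

/-- The map `L = (L₁, …, L_N)` with `L_n = ∑_{j ≥ 1} j ^ (-s) φ_{nj}`. -/
def banachMap (s : ℝ) {N : ℕ} (φ : Fin N → ∀ j, V j) : B →L[ℝ] EuclideanSpace ℝ (Fin N) :=
  assemble fun n => ∑' j : ℕ+, ((j : ℕ) : ℝ) ^ (-s) • (φ n j : StrongDual ℝ B)

/-- The probe set `E`: all maps `L` with `L_n = ∑_{j ≥ 1} j ^ (-s) φ_{nj}`, where `φ_{nj}` lies in
the unit ball of `V j`. -/
def banachProbeSet (s : ℝ) (N : ℕ) : Set (B →L[ℝ] EuclideanSpace ℝ (Fin N)) :=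
  {L | ∃ φ : Fin N → ∀ j, V j, (∀ n j, φ n j ∈ Metric.closedBall (0 : V j) 1) ∧
    L = banachMap V s φ}

/-- The probe measure: the law of `L` when the `φ_{nj}` are independent and uniformly distributed
over the unit balls of the spaces `V j`. -/
def banachProbeMeasure (b : ∀ j, Module.Basis (Fin (Module.finrank ℝ (V j))) ℝ (V j))
    (s : ℝ) (N : ℕ) : Measure (B →L[ℝ] EuclideanSpace ℝ (Fin N)) :=
  (sequenceLaw N fun j => ballLaw (V j) (b j)).map (banachMap V s)

lemma ae_mem_ball (b : ∀ j, Module.Basis (Fin (Module.finrank ℝ (V j))) ℝ (V j)) (N : ℕ) :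
    ∀ᵐ φ ∂sequenceLaw N fun j => ballLaw (V j) (b j),
      ∀ n j, φ n j ∈ Metric.closedBall (0 : V j) 1 :=
  ae_sequenceLaw N _ (fun j => Metric.closedBall (0 : V j) 1) fun j => ae_mem_ballLaw (V j) (b j)

lemma aemeasurable_banachMap (b : ∀ j, Module.Basis (Fin (Module.finrank ℝ (V j))) ℝ (V j))
    {s : ℝ} (hs : 1 < s) (N : ℕ) :
    AEMeasurable (banachMap (N := N) V s) (sequenceLaw N fun j => ballLaw (V j) (b j)) := by
  refine aemeasurable_series (W := fun j => V j)
    (T := fun j φ => ((j : ℕ) : ℝ) ^ (-s) • (φ : StrongDual ℝ B))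
    (fun j => by fun_prop) (g := id) continuous_id ?_
  filter_upwards [ae_mem_ball V b N] with φ hφ n
  exact summable_banach V hs (hφ n)

/-- For `s > 1` the probe measure is a probability measure. -/
lemma isProbabilityMeasure_banachProbeMeasure
    (b : ∀ j, Module.Basis (Fin (Module.finrank ℝ (V j))) ℝ (V j)) {s : ℝ} (hs : 1 < s) (N : ℕ) :
    IsProbabilityMeasure (banachProbeMeasure V b s N) :=
  Measure.isProbabilityMeasure_map (aemeasurable_banachMap V b hs N)

end Banach

section Hilbert

variable {H : Type*} [NormedAddCommGroup H] [InnerProductSpace ℝ H]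

/-- The mutually orthogonal subspaces `V j` detect the elements of `Z`: if `z ∈ Z` has norm between
`2 ^ (-(n + 1))` and `2 ^ (-n)`, its orthogonal projection onto `V 1 ⊕ ⋯ ⊕ V n` has norm at least
`2 ^ (-(n + 2))`. -/
def ProjDetects (V : ℕ+ → Submodule ℝ H) [∀ j, FiniteDimensional ℝ (V j)] (Z : Set H) : Prop :=
  ∀ n : ℕ+, ∀ z ∈ Z, (1 / 2 : ℝ) ^ ((n : ℕ) + 1) ≤ ‖z‖ → ‖z‖ ≤ (1 / 2 : ℝ) ^ (n : ℕ) →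
    (1 / 2 : ℝ) ^ ((n : ℕ) + 2) ≤ ‖((Finset.Icc 1 n).sup V).starProjection z‖

/-- The unit cube, centred at the origin, spanned by an orthonormal basis `e` of a subspace. -/
def unitCube {V : Submodule ℝ H} {d : ℕ} (e : OrthonormalBasis (Fin d) ℝ V) : Set V :=
  {u | ∀ i, |inner ℝ u (e i)| ≤ 1 / 2}

lemma norm_sq_le_of_mem_unitCube {V : Submodule ℝ H} {d : ℕ} (e : OrthonormalBasis (Fin d) ℝ V)
    {u : V} (hu : u ∈ unitCube e) : ‖u‖ ^ 2 ≤ d / 4 := by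
  rw [← e.sum_sq_norm_inner_left u]
  calc ∑ i, ‖inner ℝ u (e i)‖ ^ 2 ≤ ∑ _i : Fin d, (1 / 2 : ℝ) ^ 2 := by
        gcongr with i
        exact hu i
    _ = d / 4 := by simp; ring

lemma isCompact_unitCube {V : Submodule ℝ H} {d : ℕ} (e : OrthonormalBasis (Fin d) ℝ V) :
    IsCompact (unitCube e) := by
  have : FiniteDimensional ℝ V := e.toBasis.finiteDimensional_of_finite
  have : ProperSpace V := FiniteDimensional.proper_real V
  refine Metric.isCompact_of_isClosed_isBounded ?_ ?_
  · simp only [unitCube, Set.ofPred_forall]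
    exact isClosed_iInter fun i => isClosed_le (by fun_prop) continuous_const
  · refine (Metric.isBounded_closedBall (x := (0 : V)) (r := Real.sqrt (d / 4))).subset fun u hu => ?_
    simpa using Real.le_sqrt_of_sq_le (norm_sq_le_of_mem_unitCube e hu)

lemma unitCube_mem_nhds {V : Submodule ℝ H} {d : ℕ} (e : OrthonormalBasis (Fin d) ℝ V) :
    unitCube e ∈ 𝓝 (0 : V) := by
  simp only [unitCube, Set.ofPred_forall]
  refine Filter.iInter_mem.2 fun i => ?_
  have h : Continuous fun u : V => |inner ℝ u (e i)| := by fun_prop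
  filter_upwards [h.continuousAt.eventually_lt (x₀ := 0) (g := fun _ => (1 / 2 : ℝ))
    continuousAt_const (by simp)] with u hu
  exact hu.le

lemma summable_hilbert [CompleteSpace H] {V : ℕ+ → Submodule ℝ H} {d : ℕ+ → ℕ}
    (e : ∀ j, OrthonormalBasis (Fin (d j)) ℝ (V j)) (hV : Pairwise fun i j => V i ⟂ V j) {M : ℕ}
    (hM : ∀ j, d j ≤ M) {s : ℝ} (hs : 1 / 2 < s) {φ : ∀ j, V j}
    (hφ : ∀ j, φ j ∈ unitCube (e j)) :
    Summable fun j : ℕ+ => ((j : ℕ) : ℝ) ^ (-s) • (φ j : H) := by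
  have hO : OrthogonalFamily ℝ (fun j => V j) fun j => (V j).subtypeₗᵢ :=
    OrthogonalFamily.of_pairwise hV
  refine (hO.summable_iff_norm_sq_summable fun j => ((j : ℕ) : ℝ) ^ (-s) • φ j).2 ?_
  refine ((summable_pnat_rpow (s := 2 * s) (by linarith)).mul_right (M / 4 : ℝ)).of_nonneg_of_le
    (fun j => by positivity) fun j => ?_
  have h1 : ‖φ j‖ ^ 2 ≤ M / 4 := (norm_sq_le_of_mem_unitCube (e j) (hφ j)).trans (by
    gcongr
    exact hM j)
  have h2 : (((j : ℕ) : ℝ) ^ (-s)) ^ 2 = ((j : ℕ) : ℝ) ^ (-(2 * s)) := by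
    rw [← Real.rpow_natCast, ← Real.rpow_mul (by positivity)]
    congr 1
    push_cast
    ring
  rw [norm_smul, mul_pow, Real.norm_of_nonneg (by positivity), h2]
  gcongr

variable (V : ℕ+ → Submodule ℝ H) [∀ j, FiniteDimensional ℝ (V j)]
  (e : ∀ j, OrthonormalBasis (Fin (Module.finrank ℝ (V j))) ℝ (V j))

/-- The map `L = (L₁, …, L_N)` with `L_n = ⟪∑_{j ≥ 1} j ^ (-s) φ_{nj}, ·⟫`. -/
def hilbertMap (s : ℝ) {N : ℕ} (φ : Fin N → ∀ j, V j) : H →L[ℝ] EuclideanSpace ℝ (Fin N) :=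
  assemble fun n => innerSL ℝ (∑' j : ℕ+, ((j : ℕ) : ℝ) ^ (-s) • (φ n j : H))

/-- The probe set `E`: all maps `L` with `L_n = ⟪∑_{j ≥ 1} j ^ (-s) φ_{nj}, ·⟫`, where `φ_{nj}` lies
in the unit cube of `V j`. -/
def hilbertProbeSet (s : ℝ) (N : ℕ) : Set (H →L[ℝ] EuclideanSpace ℝ (Fin N)) :=
  {L | ∃ φ : Fin N → ∀ j, V j, (∀ n j, φ n j ∈ unitCube (e j)) ∧ L = hilbertMap V s φ}

variable [MeasurableSpace H] [BorelSpace H]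

/-- The uniform probability measure on the unit cube of a finite-dimensional subspace. -/
def cubeLaw (V : Submodule ℝ H) [FiniteDimensional ℝ V]
    (e : OrthonormalBasis (Fin (Module.finrank ℝ V)) ℝ V) : Measure V :=
  uniformLaw e.toBasis (unitCube e)

instance (V : Submodule ℝ H) [FiniteDimensional ℝ V]
    (e : OrthonormalBasis (Fin (Module.finrank ℝ V)) ℝ V) : IsProbabilityMeasure (cubeLaw V e) :=
  isProbabilityMeasure_uniformLaw e.toBasis (isCompact_unitCube e) (unitCube_mem_nhds e)

/-- The probe measure: the law of `L` when the `φ_{nj}` are independent and uniformly distributed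
over the unit cubes of the spaces `V j`. -/
def hilbertProbeMeasure (s : ℝ) (N : ℕ) : Measure (H →L[ℝ] EuclideanSpace ℝ (Fin N)) :=
  (sequenceLaw N fun j => cubeLaw (V j) (e j)).map (hilbertMap V s)

lemma ae_mem_cube (N : ℕ) :
    ∀ᵐ φ ∂sequenceLaw N fun j => cubeLaw (V j) (e j), ∀ n j, φ n j ∈ unitCube (e j) :=
  ae_sequenceLaw N _ (fun j => unitCube (e j))
    fun j => ae_mem_uniformLaw (e j).toBasis (isCompact_unitCube (e j))

lemma aemeasurable_hilbertMap [CompleteSpace H] (hV : Pairwise fun i j => V i ⟂ V j) {M : ℕ}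
    (hM : ∀ j, Module.finrank ℝ (V j) ≤ M) {s : ℝ} (hs : 1 / 2 < s) (N : ℕ) :
    AEMeasurable (hilbertMap (N := N) V s) (sequenceLaw N fun j => cubeLaw (V j) (e j)) := by
  refine aemeasurable_series (W := fun j => V j) (T := fun j φ => ((j : ℕ) : ℝ) ^ (-s) • (φ : H))
    (fun j => by fun_prop) (g := innerSL ℝ) (innerSL ℝ).continuous ?_
  filter_upwards [ae_mem_cube V e N] with φ hφ n
  exact summable_hilbert e hV hM hs (hφ n)

/-- For `s > 1/2` and mutually orthogonal spaces of bounded dimension the probe measure is a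
probability measure. -/
lemma isProbabilityMeasure_hilbertProbeMeasure [CompleteSpace H]
    (hV : Pairwise fun i j => V i ⟂ V j) {M : ℕ} (hM : ∀ j, Module.finrank ℝ (V j) ≤ M) {s : ℝ}
    (hs : 1 / 2 < s) (N : ℕ) : IsProbabilityMeasure (hilbertProbeMeasure V e s N) :=
  Measure.isProbabilityMeasure_map (aemeasurable_hilbertMap V e hV hM hs N)

end Hilbert

end

end LogLip

open LogLip

/-! By independence of the components it is enough to bound, for one component `X` of `L z` and
uniformly in a shift `c`, the probability of `|c + X| < r` with `r = ε 2^(-j)`; the `N`-th power of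
that bound controls the vector. An independent summand never increases such a concentration bound,
so a well-chosen part of the series suffices.

Banach case: the `j`-th term is enough. Let `ℓ` be evaluation at `z` times `j^(-s)`, and `ψ` a
detecting functional in the unit ball of `V j`. The part of the ball in the slab `|c + ℓ| < r` has
about `|ℓ ψ| / (2 r)` disjoint translates along `ψ` inside the doubled ball, whose volume is `2 ^
dim` times larger. Hence the bound `2 ^ dim * 2 r / |ℓ ψ|`.

Hilbert case: the constant must be independent of the dimensions, while the projection of `z` may be
spread over many coordinates. Now `X` is a sum of independent uniform variables on `[-1/2, 1/2]`
with coefficients `w p`, and those of the blocks `k ≤ j` satisfy `U = ∑ w p ^ 2 ≥ D ^ 2` with `D =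
j^(-s) 2^(-(j+2))`. If one `w p ^ 2` exceeds `U / 2`, the packing argument along that edge costs
only a factor `2`. Otherwise the product of the sinc factors is at most `(1 + U t ^ 2 / 32)⁻¹`,
which is integrable, and Esseen's inequality applies. Both cases give `O(r / D)`. The carriers are
`measure_le_of_translates_subset`, `measure_abs_add_lt_le_of_norm_charFun_le` and
`infinitePi_cubeLaw_abs_add_sum_lt_le`. -/

/-! ### Concentration of independent sums and of random series -/

section Concentration

variable {Ω : Type*} [MeasurableSpace Ω] {P : Measure Ω} {r : ℝ} {K : ENNReal}

/-- Adding an independent summand does not increase the concentration of a random variable. -/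
lemma measure_abs_add_lt_le_of_indepFun [IsProbabilityMeasure P] {X Y : Ω → ℝ}
    (hX : Measurable X) (hY : Measurable Y) (h : IndepFun Y X P)
    (hK : ∀ c : ℝ, P {ω | |c + X ω| < r} ≤ K) (c : ℝ) :
    P {ω | |c + (Y ω + X ω)| < r} ≤ K := by
  have hm := (indepFun_iff_map_prod_eq_prod_map_map hY.aemeasurable hX.aemeasurable).1 h
  have : IsProbabilityMeasure (P.map X) := Measure.isProbabilityMeasure_map hX.aemeasurable
  have : IsProbabilityMeasure (P.map Y) := Measure.isProbabilityMeasure_map hY.aemeasurable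
  have hA : MeasurableSet {p : ℝ × ℝ | |c + (p.1 + p.2)| < r} :=
    (isOpen_lt (by fun_prop) continuous_const).measurableSet
  have h1 : P {ω | |c + (Y ω + X ω)| < r} =
      P.map (fun ω => (Y ω, X ω)) {p : ℝ × ℝ | |c + (p.1 + p.2)| < r} := by
    rw [Measure.map_apply (hY.prodMk hX) hA]; rfl
  -- Conditioning on `Y = y` merely replaces `c` by `c + y`, which is why the bound is assumed for
  -- all shifts.
  rw [h1, hm, Measure.prod_apply hA]
  calc _ ≤ ∫⁻ _, K ∂(P.map Y) := by
        refine lintegral_mono fun y => ?_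
        rw [Measure.map_apply hX (measurable_prodMk_left hA)]
        refine le_trans (le_of_eq ?_) (hK (c + y))
        congr 1
        ext ω
        simp [add_assoc]
    _ = K := by simp

/-- A concentration bound for the terms of an almost surely convergent sequence passes to the
limit. -/
lemma measure_abs_add_lt_le_of_tendsto {S : ℕ+ → Ω → ℝ} {T : Ω → ℝ}
    (hT : ∀ᵐ ω ∂P, Tendsto (fun m => S m ω) atTop (𝓝 (T ω))) (c : ℝ) (m₀ : ℕ+)
    (hK : ∀ m ≥ m₀, P {ω | |c + S m ω| < r} ≤ K) :
    P {ω | |c + T ω| < r} ≤ K := by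
  have hmono : Monotone fun m : ℕ+ => {ω | ∀ n ≥ m, |c + S n ω| < r} :=
    fun a b hab ω hω n hn => hω n (hab.trans hn)
  -- The inequality is strict, hence an open condition: where it holds for the limit it holds for
  -- all late terms. The tail events increase, and each lies in a single event bounded by `K`.
  calc P {ω | |c + T ω| < r} ≤ P (⋃ m : ℕ+, {ω | ∀ n ≥ m, |c + S n ω| < r}) := by
        refine measure_mono_ae ?_
        filter_upwards [hT] with ω hω (h : |c + T ω| < r)
        have h1 : Tendsto (fun m => |c + S m ω|) atTop (𝓝 |c + T ω|) :=
          (tendsto_const_nhds.add hω).abs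
        exact Set.mem_iUnion.2 (eventually_atTop.1 (h1.eventually_lt_const h))
    _ = ⨆ m : ℕ+, P {ω | ∀ n ≥ m, |c + S n ω| < r} := hmono.measure_iUnion
    _ ≤ K := by
        refine iSup_le fun m => ?_
        refine le_trans (measure_mono fun ω hω => ?_) (hK (max m m₀) (le_max_right _ _))
        exact hω _ (le_max_left _ _)

end Concentration

section Series

variable {W : ℕ+ → Type*} [∀ j, MeasurableSpace (W j)] {ν : ∀ j, Measure (W j)}
  {ℓ : ∀ j, W j → ℝ} {r : ℝ} {K : ENNReal}

/-- A concentration bound for the partial sums of an almost surely convergent random series passes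
to the sum. -/
lemma infinitePi_abs_add_tsum_lt_le {X : ∀ _ : ∀ j, W j, ℝ} (c : ℝ) (j : ℕ+)
    (hX : ∀ᵐ φ ∂Measure.infinitePi ν, HasSum (fun k => ℓ k (φ k)) (X φ))
    (hK : ∀ m ≥ j, Measure.infinitePi ν {φ | |c + ∑ k ∈ Finset.Iic m, ℓ k (φ k)| < r} ≤ K) :
    Measure.infinitePi ν {φ | |c + X φ| < r} ≤ K := by
  refine measure_abs_add_lt_le_of_tendsto ?_ c j hK
  filter_upwards [hX] with φ hφ
  exact Tendsto.comp (g := fun F : Finset ℕ+ => ∑ k ∈ F, ℓ k (φ k)) hφ tendsto_finset_Iic_atTop_atTop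

variable [∀ j, IsProbabilityMeasure (ν j)]

/-- The concentration of a sum of independent random variables is at most that of each summand. -/
lemma infinitePi_abs_add_sum_lt_le_of_mem (hℓ : ∀ j, Measurable (ℓ j)) {F : Finset ℕ+} {j : ℕ+}
    (hj : j ∈ F) (hK : ∀ c : ℝ, ν j {x | |c + ℓ j x| < r} ≤ K) (c : ℝ) :
    Measure.infinitePi ν {φ | |c + ∑ k ∈ F, ℓ k (φ k)| < r} ≤ K := by
  have hi : iIndepFun (fun k (φ : ∀ j, W j) => ℓ k (φ k)) (Measure.infinitePi ν) :=
    iIndepFun_infinitePi hℓ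
  have h2 := hi.indepFun_finsetSum_of_notMem (fun k => by fun_prop) (Finset.notMem_erase j F)
  have h3 := measure_abs_add_lt_le_of_indepFun (r := r) (K := K) (by fun_prop) (by fun_prop) h2
    (fun c => ?_) c
  · refine le_trans (le_of_eq ?_) h3
    congr 1
    ext φ
    simp [Finset.sum_erase_add _ _ hj]
  · have hA : MeasurableSet {x | |c + ℓ j x| < r} :=
      measurableSet_lt (measurable_const.add (hℓ j)).abs measurable_const
    refine le_trans (le_of_eq ?_) (hK c)
    rw [← (measurePreserving_eval_infinitePi ν j).measure_preimage hA.nullMeasurableSet]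
    rfl

/-- If each component of a random vector has concentration at most `K`, and the components are
independent, then the vector lies in a ball of radius `r` with probability at most `K ^ N`. -/
lemma map_norm_add_apply_lt_le {B : Type*} [NormedAddCommGroup B] [NormedSpace ℝ B] {N : ℕ}
    {Λ : (∀ j, W j) → StrongDual ℝ B}
    {Φ : (Fin N → ∀ j, W j) → B →L[ℝ] EuclideanSpace ℝ (Fin N)}
    (hΦ : Φ = fun φ => assemble fun n => Λ (φ n))
    (hm : AEMeasurable Φ (sequenceLaw N ν)) (E : Set (B →L[ℝ] EuclideanSpace ℝ (Fin N)))
    (f : B →L[ℝ] EuclideanSpace ℝ (Fin N)) (z : B)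
    (hK : ∀ c : ℝ, Measure.infinitePi ν {ψ | |c + Λ ψ z| < r} ≤ K) :
    (sequenceLaw N ν).map Φ {L | L ∈ E ∧ ‖(f + L) z‖ < r} ≤ K ^ N := by
  have hA : MeasurableSet {L : B →L[ℝ] EuclideanSpace ℝ (Fin N) | ‖(f + L) z‖ < r} := by
    refine (isOpen_lt ?_ continuous_const).measurableSet
    have : Continuous fun L : B →L[ℝ] EuclideanSpace ℝ (Fin N) => L z :=
      (ContinuousLinearMap.apply ℝ _ z).continuous
    simp only [add_apply]
    fun_prop
  -- Discarding `L ∈ E` at once means that measurability of `E` is not needed.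
  calc _ ≤ (sequenceLaw N ν).map Φ {L | ‖(f + L) z‖ < r} := measure_mono fun L hL => hL.2
    _ = sequenceLaw N ν {φ | ‖(f + Φ φ) z‖ < r} := Measure.map_apply_of_aemeasurable hm hA
    -- A Euclidean ball lies in the cube of the same radius, on which the product measure factors.
    _ ≤ sequenceLaw N ν (Set.univ.pi fun n => {ψ | |f z n + Λ ψ z| < r}) := by
        refine measure_mono fun φ hφ n _ => ?_
        refine (lt_of_le_of_lt ?_ hφ : |f z n + Λ (φ n) z| < r)
        have h1 := PiLp.norm_apply_le ((f + Φ φ) z) n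
        simpa [hΦ, assemble_apply] using h1
    _ = ∏ n : Fin N, Measure.infinitePi ν {ψ | |f z n + Λ ψ z| < r} := Measure.pi_pi _ _
    _ ≤ ∏ _n : Fin N, K := Finset.prod_le_prod' fun n _ => hK _
    _ = K ^ N := by simp

end Series

/-! ### Slab estimates by packing translates -/

/-- Packing translates of a slab: if a linear functional `g` varies by less than `2 r` on `A`, and
the translates `A + t v`, `0 ≤ t ≤ 1`, are contained in `A'`, then the measure of `A` is at most
`2 r / |g v|` times that of `A'`. -/
lemma measure_le_of_translates_subset {E : Type*} [AddCommGroup E] [Module ℝ E]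
    [MeasurableSpace E] [MeasurableAdd E] (μ : Measure E) [μ.IsAddLeftInvariant] {A A' : Set E}
    (hA : MeasurableSet A) (g : E →ₗ[ℝ] ℝ) {r : ℝ} (hr : 0 < r)
    (hg : ∀ x ∈ A, ∀ y ∈ A, |g x - g y| < 2 * r) {v : E} (hv : g v ≠ 0)
    (hA' : ∀ x ∈ A, ∀ t : ℝ, 0 ≤ t → t ≤ 1 → t • v + x ∈ A') :
    μ A ≤ ENNReal.ofReal (2 * r / |g v|) * μ A' := by
  set a := |g v| with ha
  have ha0 : 0 < a := abs_pos.2 hv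
  -- Moving by `τ v` changes `g` by exactly `2 r` in absolute value, so distinct translates `T k`
  -- are disjoint. For `k ≤ n` one has `k τ ≤ 1`, so `n + 1` of them fit into `A'`, and `τ (n + 1) ≥
  -- 1`. A wide slab, `a < 2 r`, is the case `n = 0`.
  set n := ⌊a / (2 * r)⌋₊ with hn
  set τ := 2 * r / a with hτ
  have hτ0 : 0 < τ := by positivity
  have hτa : τ * a = 2 * r := div_mul_cancel₀ _ ha0.ne'
  set T : ℕ → Set E := fun k => (fun x => -((k * τ) • v) + x) ⁻¹' A with hT
  have hTm : ∀ k, μ (T k) = μ A := fun k => measure_preimage_add _ _ _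
  have hsub : (⋃ k ∈ Finset.range (n + 1), T k) ⊆ A' := by
    refine Set.iUnion₂_subset fun k hk x hx => ?_
    have hk' : (k : ℝ) ≤ a / (2 * r) :=
      (Nat.cast_le.2 (Finset.mem_range_succ_iff.1 hk)).trans (Nat.floor_le (by positivity))
    have h1 : k * τ ≤ 1 := by
      calc k * τ ≤ a / (2 * r) * τ := by gcongr
        _ = 1 := by rw [hτ]; field_simp
    simpa using hA' _ hx (k * τ) (by positivity) h1
  have hdisj : Set.PairwiseDisjoint (↑(Finset.range (n + 1))) T := by
    intro k _ l _ hkl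
    refine Set.disjoint_left.2 fun x hx hy => ?_
    have h1 := hg _ hx _ hy
    have h2 : g (-((k * τ) • v) + x) - g (-((l * τ) • v) + x) = ((l : ℝ) - k) * (τ * g v) := by
      simp only [map_add, map_neg, map_smul, smul_eq_mul]; ring
    have h3 : |τ * g v| = 2 * r := by rw [abs_mul, abs_of_pos hτ0, hτa]
    have h4 : (1 : ℝ) ≤ |(l : ℝ) - k| := by
      have : (1 : ℤ) ≤ |(l : ℤ) - k| := Int.one_le_abs (by omega)
      exact_mod_cast this
    rw [h2, abs_mul, h3] at h1
    nlinarith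
  have hcount : (n + 1 : ENNReal) * μ A ≤ μ A' := by
    calc (n + 1 : ENNReal) * μ A = ∑ k ∈ Finset.range (n + 1), μ (T k) := by simp [hTm]
      _ = μ (⋃ k ∈ Finset.range (n + 1), T k) :=
        (measure_biUnion_finset hdisj fun k _ => hA.preimage (measurable_const_add _)).symm
      _ ≤ μ A' := measure_mono hsub
  have hone : (1 : ENNReal) ≤ ENNReal.ofReal τ * (n + 1) := by
    have : (1 : ℝ) ≤ τ * (n + 1) := by
      calc (1 : ℝ) = τ * (a / (2 * r)) := by rw [hτ]; field_simp
        _ ≤ τ * (n + 1) := by gcongr; exact (Nat.lt_floor_add_one _).le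
    calc (1 : ENNReal) = ENNReal.ofReal 1 := by simp
      _ ≤ ENNReal.ofReal (τ * (n + 1)) := ENNReal.ofReal_le_ofReal this
      _ = _ := by
        rw [ENNReal.ofReal_mul hτ0.le]
        congr 1
        exact_mod_cast ENNReal.ofReal_natCast (n + 1)
  calc μ A = 1 * μ A := (one_mul _).symm
    _ ≤ ENNReal.ofReal τ * (n + 1) * μ A := by gcongr
    _ = ENNReal.ofReal τ * ((n + 1) * μ A) := mul_assoc _ _ _
    _ ≤ ENNReal.ofReal τ * μ A' := by gcongr

section UniformLaw

variable {W : Type*} [NormedAddCommGroup W] [NormedSpace ℝ W] [MeasurableSpace W] [BorelSpace W]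
  {d : ℕ}

/-- Slab estimate for a uniform law on `S`: if all translates `S + t v`, `0 ≤ t ≤ 1`, lie in a set
`S'` of at most `K` times the volume of `S`, the slab `|c + ℓ x| < r` has probability at most
`K (2 r / |ℓ v|)`. -/
lemma uniformLaw_abs_add_lt_le (b : Module.Basis (Fin d) ℝ W) {S S' : Set W} (hS : IsCompact S)
    (h0 : S ∈ 𝓝 (0 : W)) (ℓ : W →ₗ[ℝ] ℝ) {v : W} (hv : ℓ v ≠ 0)
    (hS' : ∀ x ∈ S, ∀ t : ℝ, 0 ≤ t → t ≤ 1 → t • v + x ∈ S') {K : ENNReal}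
    (hK : volume (b.equivFun '' S') ≤ K * volume (b.equivFun '' S)) {r : ℝ} (hr : 0 < r) (c : ℝ) :
    uniformLaw b S {x | |c + ℓ x| < r} ≤ ENNReal.ofReal (2 * r / |ℓ v|) * K := by
  have : FiniteDimensional ℝ W := b.finiteDimensional_of_finite
  have hℓ : Continuous ℓ := LinearMap.continuous_of_finiteDimensional ℓ
  have himg (U : Set W) : b.equivFun '' U = b.equivFun.symm ⁻¹' U :=
    b.equivFun.toEquiv.image_eq_preimage_symm U
  have hc : IsCompact (b.equivFun '' S) := hS.image (continuous_coord b)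
  have hpos : volume (b.equivFun '' S) ≠ 0 := by
    refine (Measure.measure_pos_of_mem_nhds volume (x := (0 : Fin d → ℝ)) ?_).ne'
    rw [himg]
    refine (continuous_coord_symm b).continuousAt.preimage_mem_nhds ?_
    rwa [map_zero]
  have hU : MeasurableSet {x : W | |c + ℓ x| < r} :=
    (isOpen_lt (by fun_prop) continuous_const).measurableSet
  have hU' : MeasurableSet (b.equivFun.symm ⁻¹' {x : W | |c + ℓ x| < r}) :=
    (continuous_coord_symm b).measurable hU
  rw [uniformLaw, Measure.map_apply (continuous_coord_symm b).measurable hU,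
    cond_apply hc.measurableSet]
  have key := measure_le_of_translates_subset (volume : Measure (Fin d → ℝ))
    (A := b.equivFun '' S ∩ b.equivFun.symm ⁻¹' {x : W | |c + ℓ x| < r}) (A' := b.equivFun '' S')
    (hc.measurableSet.inter hU') (ℓ ∘ₗ b.equivFun.symm.toLinearMap) hr (v := b.equivFun v) ?_
    (by simpa using hv) ?_
  · have h1 : (ℓ ∘ₗ b.equivFun.symm.toLinearMap) (b.equivFun v) = ℓ v := by simp
    rw [h1] at key
    calc _ ≤ (volume (b.equivFun '' S))⁻¹ *
          (ENNReal.ofReal (2 * r / |ℓ v|) * (K * volume (b.equivFun '' S))) := by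
          gcongr
          exact key.trans (by gcongr)
      _ = ENNReal.ofReal (2 * r / |ℓ v|) * K *
          ((volume (b.equivFun '' S))⁻¹ * volume (b.equivFun '' S)) := by ring
      _ = _ := by rw [ENNReal.inv_mul_cancel hpos hc.measure_lt_top.ne, mul_one]
  · rintro x ⟨-, hx⟩ y ⟨-, hy⟩
    have hx' := abs_lt.1 (show |c + ℓ (b.equivFun.symm x)| < r from hx)
    have hy' := abs_lt.1 (show |c + ℓ (b.equivFun.symm y)| < r from hy)
    change |ℓ (b.equivFun.symm x) - ℓ (b.equivFun.symm y)| < 2 * r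
    rw [abs_lt]
    constructor <;> linarith [hx'.1, hx'.2, hy'.1, hy'.2]
  · rintro x ⟨hx, -⟩ t ht0 ht1
    rw [himg] at hx ⊢
    have h2 : b.equivFun.symm (t • b.equivFun v + x) = t • v + b.equivFun.symm x := by
      rw [map_add, map_smul, LinearEquiv.symm_apply_apply]
    rw [Set.mem_preimage, h2]
    exact hS' _ hx t ht0 ht1

end UniformLaw

open scoped Pointwise in
/-- Slab estimate for the unit ball of a finite-dimensional subspace. -/
lemma ballLaw_abs_add_lt_le {D : Type*} [NormedAddCommGroup D] [NormedSpace ℝ D]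
    [MeasurableSpace D] [BorelSpace D] (V : Submodule ℝ D) [FiniteDimensional ℝ V]
    (b : Module.Basis (Fin (Module.finrank ℝ V)) ℝ V) (ℓ : V →ₗ[ℝ] ℝ) {v : V} (hv1 : ‖v‖ ≤ 1)
    (hv : ℓ v ≠ 0) {r : ℝ} (hr : 0 < r) (c : ℝ) :
    ballLaw V b {x | |c + ℓ x| < r} ≤
      ENNReal.ofReal (2 * r / |ℓ v|) * 2 ^ Module.finrank ℝ V := by
  -- Translates of the unit ball by vectors of norm at most one stay in the doubled ball; this is
  -- the source of the factor `2 ^ dim`.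
  refine uniformLaw_abs_add_lt_le b (S' := (2 : ℝ) • Metric.closedBall (0 : V) 1) (isCompact_ball V)
    (Metric.closedBall_mem_nhds 0 one_pos) ℓ hv (fun x hx t ht0 ht1 => ?_) ?_ hr c
  · rw [smul_closedBall _ _ zero_le_one]
    rw [mem_closedBall_zero_iff] at hx
    simp only [smul_zero, Real.norm_ofNat, mul_one, mem_closedBall_zero_iff]
    calc ‖t • v + x‖ ≤ ‖t • v‖ + ‖x‖ := norm_add_le _ _
      _ ≤ 1 + 1 := by
        gcongr
        rw [norm_smul, Real.norm_of_nonneg ht0]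
        exact mul_le_one₀ ht1 (norm_nonneg _) hv1
      _ = 2 := by norm_num
  · have : b.equivFun '' ((2 : ℝ) • Metric.closedBall (0 : V) 1) =
        (2 : ℝ) • (b.equivFun '' Metric.closedBall (0 : V) 1) :=
      Set.image_smul_comm _ _ _ fun x => map_smul b.equivFun _ x
    rw [this, Measure.addHaar_smul]
    simp

section Cube

variable {H : Type*} [NormedAddCommGroup H] [InnerProductSpace ℝ H]

lemma equivFun_image_unitCube {V : Submodule ℝ H} {d : ℕ} (e : OrthonormalBasis (Fin d) ℝ V) :
    e.toBasis.equivFun '' unitCube e = Set.univ.pi fun _ => Set.Icc (-(1 / 2) : ℝ) (1 / 2) := by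
  rw [show e.toBasis.equivFun '' unitCube e = e.toBasis.equivFun.symm ⁻¹' unitCube e from
    e.toBasis.equivFun.toEquiv.image_eq_preimage_symm _]
  ext x
  have (i : Fin d) : inner ℝ (e.toBasis.equivFun.symm x) (e i) = x i := by
    rw [real_inner_comm, ← e.repr_apply_apply, Module.Basis.equivFun_symm_apply]
    simp [Finset.sum_apply, Pi.single_apply]
  simp only [Set.mem_preimage, unitCube, Set.mem_ofPred_eq, this, abs_le, Set.mem_univ_pi,
    Set.mem_Icc]

variable [MeasurableSpace H] [BorelSpace H]

/-- Slab estimate for the unit cube, with a constant independent of the dimension. -/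
lemma cubeLaw_abs_add_lt_le (V : Submodule ℝ H) [FiniteDimensional ℝ V]
    (e : OrthonormalBasis (Fin (Module.finrank ℝ V)) ℝ V) (ℓ : V →ₗ[ℝ] ℝ)
    {i : Fin (Module.finrank ℝ V)} (hv : ℓ (e i) ≠ 0) {r : ℝ} (hr : 0 < r) (c : ℝ) :
    cubeLaw V e {x | |c + ℓ x| < r} ≤ ENNReal.ofReal (2 * r / |ℓ (e i)|) * 2 := by
  -- The box swept out by the cube moving along one edge: only that side is lengthened, from `1` to
  -- `2`, so the volume merely doubles in any dimension.
  set Q : Set (Fin (Module.finrank ℝ V) → ℝ) :=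
    Set.univ.pi fun k => Set.Icc (-(1 / 2) : ℝ) (if k = i then 3 / 2 else 1 / 2) with hQ
  have hbox := equivFun_image_unitCube e
  refine uniformLaw_abs_add_lt_le e.toBasis (S' := e.toBasis.equivFun ⁻¹' Q) (isCompact_unitCube e)
    (unitCube_mem_nhds e) ℓ hv (fun x hx t ht0 ht1 => ?_) ?_ hr c
  · have hx' : e.toBasis.equivFun x ∈ e.toBasis.equivFun '' unitCube e := ⟨x, hx, rfl⟩
    rw [hbox, Set.mem_univ_pi] at hx'
    rw [Set.mem_preimage, hQ, Set.mem_univ_pi]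
    intro k
    have h1 : e.toBasis.equivFun (t • e i + x) k =
        t * (if k = i then 1 else 0) + e.toBasis.equivFun x k := by
      rw [map_add, map_smul, Pi.add_apply, Pi.smul_apply, ← e.coe_toBasis,
        Module.Basis.equivFun_self, smul_eq_mul]
      simp only [eq_comm]
    have h2 := hx' k
    rw [h1]
    split_ifs <;> simp only [Set.mem_Icc] at h2 ⊢ <;> constructor <;> linarith [h2.1, h2.2]
  · rw [Set.image_preimage_eq _ e.toBasis.equivFun.surjective, hbox, hQ, volume_pi_pi, volume_pi_pi]
    simp only [Real.volume_Icc]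
    have h1 : ∀ k, ENNReal.ofReal ((if k = i then 3 / 2 else 1 / 2) - -(1 / 2)) =
        if k = i then 2 else 1 := by
      intro k
      split_ifs <;> norm_num
    simp only [h1, Finset.prod_ite_eq', Finset.mem_univ, if_true]
    norm_num

end Cube

/-! ### Decay of characteristic functions and Esseen's inequality -/

/-- This replaces sinc factors by rational ones, whose products can be expanded. For `y ^ 2 ≥ 4 / 3`
the bound `sin ^ 2 ≤ 1` is enough; for smaller `y` the double-angle formula is combined with `cos u
≤ 1 / √(u ^ 2 + 1)` at `u = y / 2`. -/
lemma sin_sq_mul_one_add_le (y : ℝ) : Real.sin y ^ 2 * (1 + y ^ 2 / 4) ≤ y ^ 2 := by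
  rcases le_total (4 / 3) (y ^ 2) with h | h
  · nlinarith [Real.sin_sq_le_one y, sq_nonneg y]
  · have hy : |y| ≤ 2 := abs_le_of_sq_le_sq (by linarith) (by norm_num)
    obtain ⟨h1, h2⟩ := abs_le.1 hy
    have hpi := Real.pi_gt_three
    have hc0 : 0 ≤ Real.cos (y / 2) := Real.cos_nonneg_of_mem_Icc ⟨by linarith, by linarith⟩
    have hc1 := Real.cos_le_one_div_sqrt_sq_add_one (x := y / 2) (by linarith) (by linarith)
    have hc2 : Real.cos (y / 2) ^ 2 ≤ 1 / (1 + y ^ 2 / 4) := by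
      calc Real.cos (y / 2) ^ 2 ≤ (1 / √((y / 2) ^ 2 + 1)) ^ 2 := by gcongr
        _ = 1 / (1 + y ^ 2 / 4) := by
          rw [div_pow, Real.sq_sqrt (by positivity)]; ring
    have hc3 : Real.cos (y / 2) ^ 2 * (1 + y ^ 2 / 4) ≤ 1 := by
      rwa [le_div_iff₀ (by positivity)] at hc2
    have hs : Real.sin (y / 2) ^ 2 ≤ (y / 2) ^ 2 := sq_le_sq.2 Real.abs_sin_le_abs
    have hsin : Real.sin y = 2 * Real.sin (y / 2) * Real.cos (y / 2) := by
      rw [← Real.sin_two_mul]; ring_nf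
    calc Real.sin y ^ 2 * (1 + y ^ 2 / 4) =
        4 * Real.sin (y / 2) ^ 2 * (Real.cos (y / 2) ^ 2 * (1 + y ^ 2 / 4)) := by rw [hsin]; ring
      _ ≤ 4 * (y / 2) ^ 2 * 1 := by gcongr
      _ = y ^ 2 := by ring

/-- Decay of the characteristic function of the uniform law on `[-1/2, 1/2]`. -/
lemma norm_sq_integral_Icc_exp_le (a : ℝ) :
    ‖∫ x in Set.Icc (-(1 / 2) : ℝ) (1 / 2), Complex.exp (a * x * Complex.I)‖ ^ 2 ≤
      (1 + a ^ 2 / 16)⁻¹ := by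
  rw [integral_Icc_eq_integral_Ioc, ← intervalIntegral.integral_of_le (by norm_num)]
  rcases eq_or_ne a 0 with rfl | ha
  · norm_num
  have h1 : ∫ x in (-(1 / 2) : ℝ)..(1 / 2), Complex.exp (a * x * Complex.I) =
      ((Real.sin (a / 2) / (a / 2) : ℝ) : ℂ) := by
    have h2 := integral_exp_mul_complex (a := -(1 / 2)) (b := 1 / 2) (c := a * Complex.I)
      (by simpa using ha)
    have h3 : ∀ x : ℝ, (a : ℂ) * x * Complex.I = a * Complex.I * x := fun x => by ring
    simp only [h3]
    rw [h2]
    have ha' : (a : ℂ) ≠ 0 := by exact_mod_cast ha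
    push_cast
    rw [Complex.sin]
    field_simp
    ring_nf
    simp only [Complex.I_sq]
    ring_nf
  rw [h1, Complex.norm_real, Real.norm_eq_abs, sq_abs, div_pow, ← one_div,
    div_le_div_iff₀ (by positivity) (by positivity)]
  calc Real.sin (a / 2) ^ 2 * (1 + a ^ 2 / 16) =
      Real.sin (a / 2) ^ 2 * (1 + (a / 2) ^ 2 / 4) := by ring
    _ ≤ 1 * (a / 2) ^ 2 := by rw [one_mul]; exact sin_sq_mul_one_add_le _

/-- Esseen's concentration inequality, for a characteristic function decaying like that of the
Laplace distribution. -/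
lemma measure_abs_add_lt_le_of_norm_charFun_le (μ : Measure ℝ) [IsProbabilityMeasure μ] {β : ℝ}
    (hβ : 0 < β) (hμ : ∀ t, ‖charFun μ t‖ ≤ (1 + β * t ^ 2)⁻¹) {r : ℝ} (hr : 0 < r) (c : ℝ) :
    μ {x | |c + x| < r} ≤ ENNReal.ofReal (4 * r / √β) := by
  -- With this variance the Gaussian characteristic function is `exp (-y ^ 2 / (2 r ^ 2))`, at least
  -- `1 / 2` for `|y| < r`: twice it is a smooth majorant of the indicator.
  set v : NNReal := ⟨1 / r ^ 2, by positivity⟩ with hv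
  have hv0 : v ≠ 0 := by
    rw [ne_eq, ← NNReal.coe_eq_zero]
    exact (show (0 : ℝ) < 1 / r ^ 2 by positivity).ne'
  set γ := gaussianReal 0 v with hγ
  have hgauss (y : ℝ) : charFun γ y = ((Real.exp (-(y ^ 2 / (2 * r ^ 2))) : ℝ) : ℂ) := by
    rw [hγ, charFun_gaussianReal, show ((v : NNReal) : ℂ) = ((1 / r ^ 2 : ℝ) : ℂ) from rfl]
    push_cast
    congr 1
    have : (r : ℂ) ≠ 0 := by exact_mod_cast hr.ne'
    field_simp
    ring
  -- Parseval's identity by Fubini: the majorant integrated against `μ` becomes `charFun μ`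
  -- integrated against the Gaussian.
  have hswap : ∫ x, charFun γ (c + x) ∂μ =
      ∫ t, Complex.exp (t * c * Complex.I) * charFun μ t ∂γ := by
    simp only [charFun_apply_real]
    rw [integral_integral_swap]
    · congr 1
      ext t
      rw [← integral_const_mul]
      congr 1
      ext x
      rw [← Complex.exp_add]
      push_cast
      ring_nf
    · refine (integrable_const (1 : ℝ)).mono' (by fun_prop) (ae_of_all _ fun p => ?_)
      obtain ⟨x, t⟩ := p
      have : (((c + x : ℝ) : ℂ) * t * Complex.I) = (((c + x) * t : ℝ) : ℂ) * Complex.I := by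
        push_cast; ring
      simp only [Function.uncurry_apply_pair]
      rw [this, Complex.norm_exp_ofReal_mul_I]
  have hsq : √β ^ 2 = β := Real.sq_sqrt hβ.le
  have hβ' : 0 < √β := Real.sqrt_pos.2 hβ
  have hfun : (fun t : ℝ => (1 + β * t ^ 2)⁻¹) = fun t => (fun u : ℝ => (1 + u ^ 2)⁻¹) (√β * t) := by
    ext t
    simp only [mul_pow, hsq]
  have hint : Integrable fun t : ℝ => (1 + β * t ^ 2)⁻¹ := by
    rw [hfun]
    exact integrable_inv_one_add_sq.comp_mul_left' hβ'.ne'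
  have hval : ∫ t : ℝ, (1 + β * t ^ 2)⁻¹ = Real.pi / √β := by
    rw [hfun, Measure.integral_comp_mul_left fun u : ℝ => (1 + u ^ 2)⁻¹, integral_univ_inv_one_add_sq,
      abs_of_pos (by positivity), smul_eq_mul]
    ring
  -- Bounding the density by its peak leaves only the integral `π / √β` of the assumed majorant.
  have hpdf (t : ℝ) : gaussianPDFReal 0 v t ≤ r / √(2 * Real.pi) := by
    rw [gaussianPDFReal_def]
    have h1 : √(2 * Real.pi * v) = √(2 * Real.pi) / r := by
      rw [show ((v : NNReal) : ℝ) = 1 / r ^ 2 from rfl, mul_one_div, Real.sqrt_div (by positivity),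
        Real.sqrt_sq hr.le]
    simp only [h1, inv_div]
    refine mul_le_of_le_one_right (by positivity) (Real.exp_le_one_iff.2 ?_)
    exact div_nonpos_of_nonpos_of_nonneg (by nlinarith [sq_nonneg (t - 0)]) (by positivity)
  have hupper : ‖∫ x, charFun γ (c + x) ∂μ‖ ≤ r / √(2 * Real.pi) * (Real.pi / √β) := by
    rw [hswap, ← hval, ← integral_const_mul, hγ, integral_gaussianReal_eq_integral_smul hv0]
    refine norm_integral_le_of_norm_le (hint.const_mul _) (ae_of_all _ fun t => ?_)
    have h1 : ‖Complex.exp (t * c * Complex.I)‖ = 1 := by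
      rw [show (t * c * Complex.I : ℂ) = ((t * c : ℝ) : ℂ) * Complex.I by push_cast; ring,
        Complex.norm_exp_ofReal_mul_I]
    rw [norm_smul, norm_mul, h1, one_mul, Real.norm_of_nonneg (gaussianPDFReal_nonneg _ _ _)]
    exact mul_le_mul (hpdf t) (hμ t) (norm_nonneg _) (by positivity)
  have hnum : 2 * (r / √(2 * Real.pi) * (Real.pi / √β)) ≤ 4 * r / √β := by
    have h1 : Real.pi / √(2 * Real.pi) ≤ 2 := by
      rw [div_le_iff₀ (by positivity)]
      nlinarith [Real.sq_sqrt (show 0 ≤ 2 * Real.pi by positivity), Real.pi_pos, Real.pi_le_four,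
        Real.sqrt_nonneg (2 * Real.pi)]
    calc 2 * (r / √(2 * Real.pi) * (Real.pi / √β)) =
        2 * (r / √β) * (Real.pi / √(2 * Real.pi)) := by ring
      _ ≤ 2 * (r / √β) * 2 := by gcongr
      _ = 4 * r / √β := by ring
  have hreal : ∫ x, charFun γ (c + x) ∂μ =
      ((∫ x, Real.exp (-((c + x) ^ 2 / (2 * r ^ 2))) ∂μ : ℝ) : ℂ) := by
    simp only [hgauss]
    exact integral_ofReal
  have hexp : ∀ x : ℝ, |c + x| < r → 1 ≤ 2 * Real.exp (-((c + x) ^ 2 / (2 * r ^ 2))) := by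
    intro x hx
    have h1 : (c + x) ^ 2 / (2 * r ^ 2) ≤ 1 / 2 := by
      rw [div_le_div_iff₀ (by positivity) (by norm_num)]
      nlinarith [sq_lt_sq' (abs_lt.1 hx).1 (abs_lt.1 hx).2]
    have h2 : 1 / 2 ≤ Real.exp (-((c + x) ^ 2 / (2 * r ^ 2))) := by
      linarith [Real.add_one_le_exp (-((c + x) ^ 2 / (2 * r ^ 2)))]
    linarith
  have hmeas : MeasurableSet {x : ℝ | |c + x| < r} :=
    (isOpen_lt (by fun_prop) continuous_const).measurableSet
  have hint' : Integrable (fun x => 2 * Real.exp (-((c + x) ^ 2 / (2 * r ^ 2)))) μ := by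
    refine (integrable_const (2 : ℝ)).mono' (by fun_prop) (ae_of_all _ fun x => ?_)
    rw [Real.norm_of_nonneg (by positivity)]
    have : Real.exp (-((c + x) ^ 2 / (2 * r ^ 2))) ≤ 1 :=
      Real.exp_le_one_iff.2 (neg_nonpos.2 (by positivity))
    linarith
  have hle : μ.real {x | |c + x| < r} ≤ 4 * r / √β := by
    calc μ.real {x | |c + x| < r} = ∫ x, ({x | |c + x| < r} : Set ℝ).indicator 1 x ∂μ :=
          (integral_indicator_one hmeas).symm
      _ ≤ ∫ x, 2 * Real.exp (-((c + x) ^ 2 / (2 * r ^ 2))) ∂μ := by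
          refine integral_mono ((integrable_const (1 : ℝ)).indicator hmeas) hint' fun x => ?_
          refine Set.indicator_apply_le' (fun hx => hexp x hx) fun _ => by positivity
      _ = 2 * ‖∫ x, charFun γ (c + x) ∂μ‖ := by
          rw [integral_const_mul, hreal, Complex.norm_real, Real.norm_of_nonneg]
          exact integral_nonneg fun x => (Real.exp_pos _).le
      _ ≤ _ := le_trans (by gcongr) hnum
  rw [← ofReal_measureReal]
  exact ENNReal.ofReal_le_ofReal hle

/-- A product of factors `1 + x i` is at least the second elementary symmetric truncation. -/
lemma one_add_sum_add_le_prod_one_add {ι : Type*} (s : Finset ι) (x : ι → ℝ) (hx : ∀ i, 0 ≤ x i) :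
    1 + ∑ i ∈ s, x i + ((∑ i ∈ s, x i) ^ 2 - ∑ i ∈ s, x i ^ 2) / 2 ≤ ∏ i ∈ s, (1 + x i) := by
  classical
  induction s using Finset.induction_on with
  | empty => simp
  | insert a s ha ih =>
    rw [Finset.sum_insert ha, Finset.sum_insert ha, Finset.prod_insert ha]
    have h1 := Finset.sum_sq_le_sq_sum_of_nonneg (s := s) fun i _ => hx i
    -- Expanding leaves one surplus term, `x a` times the second symmetric function of `s`, which is
    -- nonnegative by `h1`.
    have h2 := mul_le_mul_of_nonneg_left ih (show 0 ≤ 1 + x a by linarith [hx a])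
    nlinarith [mul_nonneg (hx a) (sub_nonneg.2 h1)]

/-- If no term dominates the sum, the product `∏ (1 + x i)` grows quadratically in the sum. -/
lemma sq_one_add_half_sum_le_prod_one_add {ι : Type*} (s : Finset ι) (x : ι → ℝ)
    (hx : ∀ i, 0 ≤ x i) (hmax : ∀ i ∈ s, x i ≤ (∑ i ∈ s, x i) / 2) :
    (1 + (∑ i ∈ s, x i) / 2) ^ 2 ≤ ∏ i ∈ s, (1 + x i) := by
  refine le_trans ?_ (one_add_sum_add_le_prod_one_add s x hx)
  -- With `S` the sum, this gives `∑ x i ^ 2 ≤ S ^ 2 / 2`, so the truncation is at least `1 + S + S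
  -- ^ 2 / 4 = (1 + S / 2) ^ 2`.
  have h1 : ∑ i ∈ s, x i ^ 2 ≤ (∑ i ∈ s, x i) / 2 * ∑ i ∈ s, x i := by
    rw [Finset.mul_sum]
    refine Finset.sum_le_sum fun i hi => ?_
    rw [sq]
    exact mul_le_mul_of_nonneg_right (hmax i hi) (hx i)
  nlinarith

section Cube

variable {H : Type*} [NormedAddCommGroup H] [InnerProductSpace ℝ H] [MeasurableSpace H]
  [BorelSpace H]

/-- Decay of the characteristic function of a linear marginal of the unit cube. -/
lemma norm_sq_charFun_map_cubeLaw_le (V : Submodule ℝ H) [FiniteDimensional ℝ V]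
    (e : OrthonormalBasis (Fin (Module.finrank ℝ V)) ℝ V) (ℓ : V →ₗ[ℝ] ℝ) (t : ℝ) :
    ‖charFun ((cubeLaw V e).map ℓ) t‖ ^ 2 ≤ ∏ i, (1 + t ^ 2 * ℓ (e i) ^ 2 / 16)⁻¹ := by
  have hℓ : Continuous ℓ := LinearMap.continuous_of_finiteDimensional ℓ
  have hvol : volume (Set.univ.pi fun _ : Fin (Module.finrank ℝ V) =>
      Set.Icc (-(1 / 2) : ℝ) (1 / 2)) = 1 := by
    rw [volume_pi_pi]
    norm_num
  have hcoord (x : Fin (Module.finrank ℝ V) → ℝ) :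
      ℓ (e.toBasis.equivFun.symm x) = ∑ i, x i * ℓ (e i) := by
    rw [Module.Basis.equivFun_symm_apply]
    simp
  -- In orthonormal coordinates the cube is a product of intervals of total volume `1`, so the
  -- normalisation disappears and the integral factors.
  have heq : charFun ((cubeLaw V e).map ℓ) t =
      ∏ i, ∫ x in Set.Icc (-(1 / 2) : ℝ) (1 / 2),
        Complex.exp (((t * ℓ (e i) : ℝ) : ℂ) * x * Complex.I) := by
    rw [charFun_apply_real, integral_map hℓ.aemeasurable (by fun_prop), cubeLaw, uniformLaw,
      integral_map (continuous_coord_symm _).aemeasurable (by fun_prop), ProbabilityTheory.cond,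
      equivFun_image_unitCube, hvol, inv_one, one_smul, volume_pi, Measure.restrict_pi_pi]
    simp only [hcoord]
    rw [← integral_fintype_prod_eq_prod]
    congr 1
    ext x
    rw [← Complex.exp_sum]
    congr 1
    push_cast
    rw [Finset.mul_sum, Finset.sum_mul]
    exact Finset.sum_congr rfl fun i _ => by ring
  rw [heq, norm_prod, ← Finset.prod_pow]
  refine Finset.prod_le_prod (fun i _ => by positivity) fun i _ => ?_
  rw [← mul_pow]
  exact norm_sq_integral_Icc_exp_le _

end Cube

/-! ### Dimension-free anticoncentration in Hilbert space -/

section Hilbert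

variable {H : Type*} [NormedAddCommGroup H] [InnerProductSpace ℝ H]

/-- Anticoncentration of a linear functional of independent points of unit cubes, with a constant
independent of all dimensions. -/
lemma infinitePi_cubeLaw_abs_add_sum_lt_le [MeasurableSpace H] [BorelSpace H]
    (V : ℕ+ → Submodule ℝ H) [∀ j, FiniteDimensional ℝ (V j)]
    (e : ∀ j, OrthonormalBasis (Fin (Module.finrank ℝ (V j))) ℝ (V j)) (ℓ : ∀ k, V k →ₗ[ℝ] ℝ)
    {F G : Finset ℕ+} (hGF : G ⊆ F) {D : ℝ} (hD : 0 < D)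
    (hDG : D ^ 2 ≤ ∑ k ∈ G, ∑ i, ℓ k (e k i) ^ 2) {r : ℝ} (hr : 0 < r) (c : ℝ) :
    Measure.infinitePi (fun j => cubeLaw (V j) (e j)) {φ | |c + ∑ k ∈ F, ℓ k (φ k)| < r} ≤
      ENNReal.ofReal (24 * r / D) := by
  have hℓ : ∀ k, Measurable (ℓ k) := fun k =>
    (LinearMap.continuous_of_finiteDimensional (ℓ k)).measurable
  set P := Measure.infinitePi fun j => cubeLaw (V j) (e j) with hP
  set I : Finset (Σ k : ℕ+, Fin (Module.finrank ℝ (V k))) := G.sigma fun _ => Finset.univ with hI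
  set w : (Σ k : ℕ+, Fin (Module.finrank ℝ (V k))) → ℝ := fun p => ℓ p.1 (e p.1 p.2) with hw
  set U := ∑ p ∈ I, w p ^ 2 with hU
  have hUD : D ^ 2 ≤ U := by rwa [hU, hI, Finset.sum_sigma]
  -- The split is needed because a single uniform variable has a characteristic function decaying
  -- only like `1 / t`, which is not integrable.
  by_cases hbig : ∃ p ∈ I, U / 2 < w p ^ 2
  · obtain ⟨⟨k, i⟩, hp, hlarge⟩ := hbig
    have hk : k ∈ F := hGF (Finset.mem_sigma.1 hp).1
    have hlarge' : D ^ 2 / 2 < ℓ k (e k i) ^ 2 := by linarith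
    have hne : ℓ k (e k i) ≠ 0 := by
      rintro h
      rw [h] at hlarge'
      nlinarith
    have hD' : D / 2 ≤ |ℓ k (e k i)| := by
      refine le_of_sq_le_sq ?_ (abs_nonneg _)
      rw [sq_abs]
      nlinarith
    refine infinitePi_abs_add_sum_lt_le_of_mem hℓ hk (fun c => ?_) c
    refine (cubeLaw_abs_add_lt_le (V k) (e k) (ℓ k) hne hr c).trans ?_
    rw [show (2 : ENNReal) = ENNReal.ofReal 2 by simp, ← ENNReal.ofReal_mul (by positivity)]
    refine ENNReal.ofReal_le_ofReal ?_
    calc 2 * r / |ℓ k (e k i)| * 2 ≤ 2 * r / (D / 2) * 2 := by gcongr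
      _ = 8 * r / D := by field_simp; norm_num
      _ ≤ 24 * r / D := by gcongr; norm_num
  · push Not at hbig
    have hi : iIndepFun (fun k (φ : ∀ j, V j) => ℓ k (φ k)) P := iIndepFun_infinitePi hℓ
    have hS : Measurable fun φ : ∀ j, V j => ∑ k ∈ F, ℓ k (φ k) := by fun_prop
    have hmarg (k : ℕ+) : P.map (fun φ : ∀ j, V j => ℓ k (φ k)) =
        (cubeLaw (V k) (e k)).map (ℓ k) := by
      rw [hP, ← Measure.infinitePi_map_eval (fun j => cubeLaw (V j) (e j)) k,
        Measure.map_map (hℓ k) (by fun_prop)]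
      rfl
    have hprob (k : ℕ+) : IsProbabilityMeasure ((cubeLaw (V k) (e k)).map (ℓ k)) :=
      Measure.isProbabilityMeasure_map (hℓ k).aemeasurable
    have : IsProbabilityMeasure (P.map fun φ : ∀ j, V j => ∑ k ∈ F, ℓ k (φ k)) :=
      Measure.isProbabilityMeasure_map hS.aemeasurable
    have hchar (t : ℝ) : ‖charFun (P.map fun φ : ∀ j, V j => ∑ k ∈ F, ℓ k (φ k)) t‖ ≤
        (1 + U / 32 * t ^ 2)⁻¹ := by
      have h1 := congrFun ((hi.restrict F).charFun_map_fun_finsetSum_eq_prod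
        (X := fun k (φ : ∀ j, V j) => ℓ k (φ k))
        fun k _ => ((hℓ k).comp (measurable_pi_apply k)).aemeasurable) t
      simp only [Finset.prod_apply, hmarg] at h1
      have hsum : ∑ p ∈ I, t ^ 2 * w p ^ 2 / 16 = t ^ 2 * U / 16 := by
        rw [hU, Finset.mul_sum, Finset.sum_div]
      have h2 := sq_one_add_half_sum_le_prod_one_add I (fun p => t ^ 2 * w p ^ 2 / 16)
        (fun p => by positivity) fun p hp => by
          rw [hsum]
          nlinarith [mul_le_mul_of_nonneg_left (hbig p hp) (sq_nonneg t)]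
      rw [hsum] at h2
      have hU0 : 0 ≤ U := (sq_nonneg D).trans hUD
      rw [h1, norm_prod]
      refine le_of_sq_le_sq ?_ (by positivity)
      -- Blocks outside `G` contribute factors of modulus at most one.
      calc (∏ k ∈ F, ‖charFun ((cubeLaw (V k) (e k)).map (ℓ k)) t‖) ^ 2
          ≤ (∏ k ∈ G, ‖charFun ((cubeLaw (V k) (e k)).map (ℓ k)) t‖) ^ 2 := by
            refine pow_le_pow_left₀ (Finset.prod_nonneg fun _ _ => norm_nonneg _) ?_ 2
            rw [← Finset.prod_sdiff hGF]
            exact mul_le_of_le_one_left (Finset.prod_nonneg fun _ _ => norm_nonneg _)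
              (Finset.prod_le_one (fun _ _ => norm_nonneg _) fun k _ => norm_charFun_le_one t)
        _ ≤ ∏ k ∈ G, ∏ i, (1 + t ^ 2 * ℓ k (e k i) ^ 2 / 16)⁻¹ := by
            rw [← Finset.prod_pow]
            exact Finset.prod_le_prod (fun _ _ => by positivity)
              fun k _ => norm_sq_charFun_map_cubeLaw_le (V k) (e k) (ℓ k) t
        _ = (∏ p ∈ I, (1 + t ^ 2 * w p ^ 2 / 16))⁻¹ := by
            rw [hI, Finset.prod_sigma, ← Finset.prod_inv_distrib]
            simp only [← Finset.prod_inv_distrib, hw]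
        _ ≤ ((1 + t ^ 2 * U / 16 / 2) ^ 2)⁻¹ := inv_anti₀ (by positivity) h2
        _ = ((1 + U / 32 * t ^ 2)⁻¹) ^ 2 := by rw [inv_pow]; ring_nf
    have hU0 : 0 < U := (by positivity : 0 < D ^ 2).trans_le hUD
    have h3 := measure_abs_add_lt_le_of_norm_charFun_le _ (β := U / 32) (by positivity) hchar hr c
    rw [Measure.map_apply hS ((isOpen_lt (by fun_prop) continuous_const).measurableSet)] at h3
    refine le_trans h3 (ENNReal.ofReal_le_ofReal ?_)
    -- Since `32 ≤ 36`, Esseen's constant `4` becomes `4 * 6 = 24`, which also covers the `8` of the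
    -- first case.
    have h4 : D / 6 ≤ √(U / 32) := Real.le_sqrt_of_sq_le (by nlinarith)
    calc 4 * r / √(U / 32) ≤ 4 * r / (D / 6) := by gcongr
      _ = 24 * r / D := by field_simp; norm_num

/-- The projection onto the span of finitely many mutually orthogonal subspaces, in terms of
orthonormal bases of these. -/
lemma norm_sq_starProjection_sup_eq (V : ℕ+ → Submodule ℝ H) [∀ j, FiniteDimensional ℝ (V j)]
    (hV : Pairwise fun i j => V i ⟂ V j)
    (e : ∀ j, OrthonormalBasis (Fin (Module.finrank ℝ (V j))) ℝ (V j)) (G : Finset ℕ+) (z : H) :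
    ‖(G.sup V).starProjection z‖ ^ 2 = ∑ k ∈ G, ∑ i, inner ℝ (e k i : H) z ^ 2 := by
  have hO : OrthogonalFamily ℝ (fun j => V j) fun j => (V j).subtypeₗᵢ :=
    OrthogonalFamily.of_pairwise hV
  have hproj : (G.sup V).starProjection z = ∑ k ∈ G, (V k).starProjection z := by
    refine Submodule.eq_starProjection_of_mem_orthogonal ?_ ?_
    · exact Submodule.sum_mem _ fun k hk =>
        (Finset.le_sup hk : V k ≤ G.sup V) (Submodule.starProjection_apply_mem _ _)
    -- Written as an inclusion in one orthogonal complement, the claim can be checked on each `V l`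
    -- separately; there only the `l`-th projection contributes.
    · have hle : G.sup V ≤ (ℝ ∙ (z - ∑ k ∈ G, (V k).starProjection z))ᗮ := by
        refine Finset.sup_le fun l hl u hu => ?_
        rw [Submodule.mem_orthogonal_singleton_iff_inner_right, inner_sub_left, sum_inner,
          Finset.sum_eq_single_of_mem l hl, ← inner_sub_left]
        · exact Submodule.starProjection_inner_eq_zero z u hu
        · intro k _ hkl
          exact (hV hkl).inner_eq (Submodule.starProjection_apply_mem _ _) hu
      rw [Submodule.mem_orthogonal]
      intro u hu
      rw [real_inner_comm]
      exact Submodule.mem_orthogonal_singleton_iff_inner_right.1 (hle hu)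
  have hnorm : ‖∑ k ∈ G, (V k).starProjection z‖ ^ 2 =
      ∑ k ∈ G, ‖(V k).orthogonalProjectionOnto z‖ ^ 2 :=
    hO.norm_sum (fun k => (V k).orthogonalProjectionOnto z) G
  rw [hproj]
  refine hnorm.trans (Finset.sum_congr rfl fun k _ => ?_)
  rw [← (e k).sum_sq_norm_inner_right]
  refine Finset.sum_congr rfl fun i _ => ?_
  rw [Real.norm_eq_abs, sq_abs]
  congr 1
  exact Submodule.inner_orthogonalProjectionOnto_eq_of_mem_left (e k i) z

end Hilbert

/-! ### Constants and conclusion -/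

/-- This is the ratio of `r` to the guaranteed coefficient size, where the scale `2^(-j)` cancels.
The Banach case uses `κ = 2`, `m = 3`, the Hilbert case `κ = 24`, `m = 2`. -/
lemma rpow_mul_half_pow_ratio {s ε κ : ℝ} (j : ℕ+) (m : ℕ) :
    κ * (ε * (1 / 2 : ℝ) ^ (j : ℕ)) / (((j : ℕ) : ℝ) ^ (-s) * (1 / 2 : ℝ) ^ ((j : ℕ) + m)) =
      κ * 2 ^ m * (ε * ((j : ℕ) : ℝ) ^ s) := by
  have hj : (0 : ℝ) < ((j : ℕ) : ℝ) := by exact_mod_cast j.pos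
  have h1 : (0 : ℝ) < ((j : ℕ) : ℝ) ^ s := by positivity
  rw [Real.rpow_neg hj.le, pow_add]
  simp only [one_div, inv_pow]
  field_simp

lemma ofReal_mul_rpow_pow {s ε κ : ℝ} (hκ : 0 ≤ κ) (hε : 0 ≤ ε) (j : ℕ+) (N : ℕ) :
    ENNReal.ofReal (κ * (ε * ((j : ℕ) : ℝ) ^ s)) ^ N =
      ENNReal.ofReal (κ ^ N * ε ^ N * ((j : ℕ) : ℝ) ^ (s * N)) := by
  rw [← ENNReal.ofReal_pow (by positivity), mul_pow, mul_pow, ← Real.rpow_mul_natCast (by positivity),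
    mul_assoc]

theorem lemma2p3 (N : ℕ) :
    (∀ M : ℕ, ∃ C : ℝ, 0 < C ∧
      ∀ (B : Type u) [NormedAddCommGroup B] [NormedSpace ℝ B] [CompleteSpace B] (Z : Set B)
        (V : ℕ+ → Submodule ℝ (StrongDual ℝ B)) [∀ j, FiniteDimensional ℝ (V j)]
        (b : ∀ j, Module.Basis (Fin (Module.finrank ℝ (V j))) ℝ (V j)) (s : ℝ),
        (∀ j, Module.finrank ℝ (V j) ≤ M) → DualDetects V Z → 1 < s →
        ∀ (j : ℕ+) (z : B), z ∈ Z → (1 / 2 : ℝ) ^ ((j : ℕ) + 1) ≤ ‖z‖ →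
          ‖z‖ ≤ (1 / 2 : ℝ) ^ (j : ℕ) →
        ∀ (f : B →L[ℝ] EuclideanSpace ℝ (Fin N)) (ε : ℝ), 0 < ε →
          banachProbeMeasure V b s N
              {L | L ∈ banachProbeSet V s N ∧ ‖(f + L) z‖ < ε * (1 / 2 : ℝ) ^ (j : ℕ)} ≤
            ENNReal.ofReal (C * ε ^ N * ((j : ℕ) : ℝ) ^ (s * N))) ∧
    (∃ C : ℝ, 0 < C ∧
      ∀ (H : Type u) [NormedAddCommGroup H] [InnerProductSpace ℝ H] [CompleteSpace H]
        [MeasurableSpace H] [BorelSpace H] (Z : Set H)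
        (V : ℕ+ → Submodule ℝ H) [∀ j, FiniteDimensional ℝ (V j)]
        (e : ∀ j, OrthonormalBasis (Fin (Module.finrank ℝ (V j))) ℝ (V j)) (s : ℝ) (M : ℕ),
        (∀ j, Module.finrank ℝ (V j) ≤ M) → (Pairwise fun i j => V i ⟂ V j) →
        ProjDetects V Z → 1 / 2 < s →
        ∀ (j : ℕ+) (z : H), z ∈ Z → (1 / 2 : ℝ) ^ ((j : ℕ) + 1) ≤ ‖z‖ →
          ‖z‖ ≤ (1 / 2 : ℝ) ^ (j : ℕ) →
        ∀ (f : H →L[ℝ] EuclideanSpace ℝ (Fin N)) (ε : ℝ), 0 < ε →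
          hilbertProbeMeasure V e s N
              {L | L ∈ hilbertProbeSet V e s N ∧ ‖(f + L) z‖ < ε * (1 / 2 : ℝ) ^ (j : ℕ)} ≤
            ENNReal.ofReal (C * ε ^ N * ((j : ℕ) : ℝ) ^ (s * N))) := by
  -- The factors `2 ^ 3` and `2 ^ 2` come from the detection thresholds, `2` and `24` from the
  -- concentration bounds, and `2 ^ M` from doubling the ball.
  refine ⟨fun M => ⟨(2 * 2 ^ 3 * 2 ^ M) ^ N, by positivity, ?_⟩,
    ⟨(24 * 2 ^ 2) ^ N, by positivity, ?_⟩⟩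
  · intro B _ _ _ Z V _ b s hM hZ hs j z hz hz1 hz2 f ε hε
    obtain ⟨ψ, hψV, hψ1, hψz⟩ := hZ j z hz hz1 hz2
    have hj : (0 : ℝ) < ((j : ℕ) : ℝ) := by exact_mod_cast j.pos
    let ev : StrongDual ℝ B →ₗ[ℝ] ℝ := (ContinuousLinearMap.apply ℝ ℝ z).toLinearMap
    let ℓ : ∀ k : ℕ+, V k →ₗ[ℝ] ℝ := fun k => ((k : ℕ) : ℝ) ^ (-s) • (ev ∘ₗ (V k).subtype)
    have hℓ (k : ℕ+) (φ : V k) : ℓ k φ = (((k : ℕ) : ℝ) ^ (-s) • (φ : StrongDual ℝ B)) z := rfl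
    have hℓm (k : ℕ+) : Measurable (ℓ k) :=
      (((ContinuousLinearMap.apply ℝ ℝ z).continuous.comp continuous_subtype_val).const_smul
        (((k : ℕ) : ℝ) ^ (-s))).measurable
    have hψ : ((j : ℕ) : ℝ) ^ (-s) * (1 / 2 : ℝ) ^ ((j : ℕ) + 3) ≤ |ℓ j ⟨ψ, hψV⟩| := by
      rw [hℓ, smul_apply, smul_eq_mul, abs_mul, abs_of_pos (by positivity)]
      gcongr
    have hψ0 : ℓ j ⟨ψ, hψV⟩ ≠ 0 := abs_pos.1 (lt_of_lt_of_le (by positivity) hψ)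
    refine (map_norm_add_apply_lt_le (ν := fun j => ballLaw (V j) (b j))
      (Λ := fun φ => ∑' k : ℕ+, ((k : ℕ) : ℝ) ^ (-s) • (φ k : StrongDual ℝ B))
      (K := ENNReal.ofReal (2 * 2 ^ 3 * 2 ^ M * (ε * ((j : ℕ) : ℝ) ^ s))) rfl
      (aemeasurable_banachMap V b hs N) _ f z fun c => ?_).trans
      (ofReal_mul_rpow_pow (by positivity) hε.le j N).le
    -- Every partial sum up to `m ≥ j` contains the `j`-th term, whose concentration bound it
    -- inherits.
    refine infinitePi_abs_add_tsum_lt_le (ℓ := fun k => ℓ k) c j ?_ fun m hm =>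
      infinitePi_abs_add_sum_lt_le_of_mem hℓm (Finset.mem_Iic.2 hm) (fun c => ?_) c
    · have hae : ∀ᵐ φ ∂Measure.infinitePi fun j => ballLaw (V j) (b j),
          ∀ k, φ k ∈ Metric.closedBall (0 : V k) 1 :=
        ae_all_iff.2 fun k => (measurePreserving_eval_infinitePi _ k).quasiMeasurePreserving.ae
          (ae_mem_ballLaw (V k) (b k))
      filter_upwards [hae] with φ hφ
      exact (summable_banach V hs hφ).hasSum.map ev (ContinuousLinearMap.apply ℝ ℝ z).continuous
    · refine (ballLaw_abs_add_lt_le (V j) (b j) (ℓ j) (v := ⟨ψ, hψV⟩) hψ1.le hψ0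
        (by positivity) c).trans ?_
      calc _ ≤ ENNReal.ofReal (2 * 2 ^ 3 * (ε * ((j : ℕ) : ℝ) ^ s)) * ENNReal.ofReal (2 ^ M) := by
            rw [ENNReal.ofReal_pow zero_le_two, ENNReal.ofReal_ofNat]
            gcongr
            · rw [← rpow_mul_half_pow_ratio]
              gcongr
            · exact one_le_two
            · exact hM j
        _ = _ := by
            rw [← ENNReal.ofReal_mul (by positivity)]
            ring_nf
  · intro H _ _ _ _ _ Z V _ e s M hM hV hZ hs j z hz hz1 hz2 f ε hε
    have hj : (0 : ℝ) < ((j : ℕ) : ℝ) := by exact_mod_cast j.pos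
    let ℓ : ∀ k : ℕ+, V k →ₗ[ℝ] ℝ := fun k =>
      ((k : ℕ) : ℝ) ^ (-s) • ((innerSL ℝ z).toLinearMap ∘ₗ (V k).subtype)
    have hℓ (k : ℕ+) (φ : V k) : ℓ k φ = ((k : ℕ) : ℝ) ^ (-s) * inner ℝ z (φ : H) := rfl
    -- The dimension bound `M` serves only the almost sure convergence of the series and does not
    -- enter the constant.
    refine (map_norm_add_apply_lt_le (ν := fun j => cubeLaw (V j) (e j))
      (Λ := fun φ => innerSL ℝ (∑' k : ℕ+, ((k : ℕ) : ℝ) ^ (-s) • (φ k : H)))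
      (K := ENNReal.ofReal (24 * 2 ^ 2 * (ε * ((j : ℕ) : ℝ) ^ s))) rfl
      (aemeasurable_hilbertMap V e hV hM hs N) _ f z fun c => ?_).trans
      (ofReal_mul_rpow_pow (by positivity) hε.le j N).le
    refine infinitePi_abs_add_tsum_lt_le (ℓ := fun k => ℓ k) c j ?_ fun m hm => ?_
    · have hae : ∀ᵐ φ ∂Measure.infinitePi fun j => cubeLaw (V j) (e j),
          ∀ k, φ k ∈ unitCube (e k) :=
        ae_all_iff.2 fun k => (measurePreserving_eval_infinitePi _ k).quasiMeasurePreserving.ae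
          (ae_mem_uniformLaw (e k).toBasis (isCompact_unitCube (e k)))
      filter_upwards [hae] with φ hφ
      have h1 := (summable_hilbert e hV hM hs hφ).hasSum.mapL (innerSL ℝ z)
      simp only [innerSL_apply_apply, inner_smul_right] at h1
      rw [innerSL_apply_apply, real_inner_comm]
      exact h1
    · rw [← rpow_mul_half_pow_ratio]
      refine infinitePi_cubeLaw_abs_add_sum_lt_le V e ℓ (G := Finset.Icc 1 j)
        (fun k hk => Finset.mem_Iic.2 ((Finset.mem_Icc.1 hk).2.trans hm)) (by positivity) ?_
        (by positivity) c
      have h1 := hZ j z hz hz1 hz2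
      -- Since `s > 0`, the weights `k^(-s)` with `k ≤ j` are all at least `j^(-s)`; replacing them
      -- by this smallest one leaves the norm of the projection.
      calc (((j : ℕ) : ℝ) ^ (-s) * (1 / 2 : ℝ) ^ ((j : ℕ) + 2)) ^ 2
          ≤ (((j : ℕ) : ℝ) ^ (-s)) ^ 2 * ‖((Finset.Icc 1 j).sup V).starProjection z‖ ^ 2 := by
            rw [mul_pow]
            gcongr
        _ = ∑ k ∈ Finset.Icc 1 j, (((j : ℕ) : ℝ) ^ (-s)) ^ 2 * ∑ i, inner ℝ (e k i : H) z ^ 2 := by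
            rw [norm_sq_starProjection_sup_eq V hV e, Finset.mul_sum]
        _ ≤ ∑ k ∈ Finset.Icc 1 j, ∑ i, ℓ k (e k i) ^ 2 := by
            refine Finset.sum_le_sum fun k hk => ?_
            have hk0 : (0 : ℝ) < ((k : ℕ) : ℝ) := by exact_mod_cast k.pos
            have hkj : ((k : ℕ) : ℝ) ≤ ((j : ℕ) : ℝ) := by
              exact_mod_cast (Finset.mem_Icc.1 hk).2
            have hpow : ((j : ℕ) : ℝ) ^ (-s) ≤ ((k : ℕ) : ℝ) ^ (-s) :=
              Real.rpow_le_rpow_of_nonpos hk0 hkj (by linarith)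
            rw [Finset.mul_sum]
            refine Finset.sum_le_sum fun i _ => ?_
            rw [hℓ, mul_pow, real_inner_comm]
            gcongr
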